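/- Let $G$ be a finite simple graph. For an edge $xy$ of $G$ let $\theta(xy) = d(x) + d(y)$, where $d(v)$ is the degree of the vertex $v$ in $G$, and let the Ore-degree of $G$ be $\theta(G) = \max_{xy \in E(G)} \theta(xy)$ (with $\theta(G) = 0$ if $G$ has no edges). Let $\chi(G)$ be the chromatic number of $G$. If $6 \leq \chi(G) = \left\lfloor \frac{\theta(G)}{2} \right\rfloor + 1$, then $G$ contains the complete graph $K_{\chi(G)}$ as a subgraph. -/

import Mathlib

namespace SimpleGraph

/-- The Ore-degree `θ(xy) = d(x) + d(y)` of an edge `xy` of a finite graph. -/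
def edgeOreDegree {V : Type*} [Fintype V] (G : SimpleGraph V) [DecidableRel G.Adj] :
    Sym2 V → ℕ :=
  Sym2.lift ⟨fun x y => G.degree x + G.degree y, fun _ _ => Nat.add_comm _ _⟩

/-- The Ore-degree `θ(G)` of a finite graph: the maximum of the Ore-degrees of its edges
(and `0` if there are no edges). -/
def oreDegree {V : Type*} [Fintype V] [DecidableEq V] (G : SimpleGraph V)
    [DecidableRel G.Adj] : ℕ :=
  G.edgeFinset.sup G.edgeOreDegree

end SimpleGraph

namespace OreBrooks

open Finset

set_option linter.unusedSectionVars false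

/-! Put n = ⌊θ/2⌋ and pass to an induced subgraph that is critical for n colours. Its degrees are at
least n and the degrees along an edge sum to at most 2n + 1, so every degree is n ("low") or n + 1
("high") and the high vertices are independent.

Split the n colours as 2 + (n - 2) and the vertices into two sides minimising a Lovász potential. In
such a partition, a subset of a side that is critical for that side's colours is a regular component
of the side. Moving a low vertex out of it keeps the potential minimal; if the number of critical
sets is also minimal, the move must create a critical set on the other side (`Setting.good_flip`).
Repeated moves form a walk, which by finiteness meets a set it left behind. The first return yields
adjacent low vertices p, q that attach to the same set when moved (`exists_linked_of_return`).
Regularity then forces every low neighbour of p to have the same closed neighbourhood as p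
(`Linked.adj_of_low`).

If p has at most one high neighbour, N[p] is the required clique. Otherwise colour the graph without
p. Each of the h high neighbours retains at least n - h colours against the vertices outside N[p],
and h(n - h) > n, so two of them can share a colour. The rest of N[p] is then coloured greedily,
with p last, contradicting criticality (`isNClique_of_adj_of_low`). -/

/-- The subgraph induced on `S` is properly `m`-colourable. -/
def ColOn {V : Type*} (G : SimpleGraph V) (S : Finset V) (m : ℕ) : Prop :=
  ∃ c : V → Fin m, ∀ x ∈ S, ∀ y ∈ S, G.Adj x y → c x ≠ c y

/-- The subgraph induced on `S` is not `m`-colourable, but deleting any vertex makes it so. -/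
def Critical {V : Type*} [DecidableEq V] (G : SimpleGraph V) (S : Finset V) (m : ℕ) : Prop :=
  ¬ ColOn G S m ∧ ∀ v ∈ S, ColOn G (S.erase v) m

/-! ### Colour-critical vertex sets -/

section Critical

variable {V : Type*} {G : SimpleGraph V}

theorem ColOn.mono {S T : Finset V} {m : ℕ} (h : ColOn G T m) (hST : S ⊆ T) : ColOn G S m := by
  obtain ⟨c, hc⟩ := h
  exact ⟨c, fun x hx y hy => hc x (hST hx) y (hST hy)⟩

variable [DecidableEq V]

theorem Critical.colOn_of_ssubset {S T : Finset V} {m : ℕ} (h : Critical G S m) (hT : T ⊂ S) :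
    ColOn G T m := by
  obtain ⟨v, hv, hvT⟩ := exists_of_ssubset hT
  exact (h.2 v hv).mono fun x hx => mem_erase.2 ⟨fun e => hvT (e ▸ hx), hT.1 hx⟩

theorem exists_critical {S : Finset V} {m : ℕ} (h : ¬ ColOn G S m) :
    ∃ T ⊆ S, Critical G T m := by
  induction S using Finset.strongInduction with
  | H S ih =>
    by_cases hS : ∀ v ∈ S, ColOn G (S.erase v) m
    · exact ⟨S, Subset.refl _, h, hS⟩
    · push Not at hS
      obtain ⟨v, hv, hc⟩ := hS
      obtain ⟨T, hT, hT'⟩ := ih _ (erase_ssubset hv) hc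
      exact ⟨T, hT.trans (erase_subset _ _), hT'⟩

/-- Colouring one more vertex. -/
theorem exists_extend [DecidableRel G.Adj] {S : Finset V} {m : ℕ} {c : V → Fin m}
    (hc : ∀ x ∈ S, ∀ y ∈ S, G.Adj x y → c x ≠ c y) {v : V} (hv : v ∉ S)
    (hlt : ((S.filter (G.Adj v)).image c).card < m) :
    ∃ c' : V → Fin m, (∀ x ∈ insert v S, ∀ y ∈ insert v S, G.Adj x y → c' x ≠ c' y) ∧
      ∀ x ∈ S, c' x = c x := by
  obtain ⟨γ, hγ⟩ : ∃ γ, γ ∉ (S.filter (G.Adj v)).image c := by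
    by_contra! h
    have := card_le_card (fun x _ => h x : (univ : Finset (Fin m)) ⊆ _)
    rw [card_univ, Fintype.card_fin] at this
    omega
  have hn : ∀ x ∈ S, x ≠ v := fun x hx e => hv (e ▸ hx)
  have hγ' : ∀ x ∈ S, G.Adj v x → c x ≠ γ := fun x hx ha e =>
    hγ (mem_image.2 ⟨x, mem_filter.2 ⟨hx, ha⟩, e⟩)
  refine ⟨Function.update c v γ, ?_, fun x hx => Function.update_of_ne (hn x hx) _ _⟩
  intro x hx y hy ha
  rcases mem_insert.1 hx with rfl | hx'
  · rcases mem_insert.1 hy with rfl | hy'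
    · exact absurd ha (G.loopless.irrefl _)
    · rw [Function.update_self, Function.update_of_ne (hn y hy')]
      exact (hγ' y hy' ha).symm
  · rcases mem_insert.1 hy with rfl | hy'
    · rw [Function.update_self, Function.update_of_ne (hn x hx')]
      exact hγ' x hx' ha.symm
    · rw [Function.update_of_ne (hn y hy'), Function.update_of_ne (hn x hx')]
      exact hc x hx' y hy' ha

/-- Greedy colouring of a set of vertices of small degree. -/
theorem exists_extend_set [DecidableRel G.Adj] {S : Finset V} {m : ℕ} {c : V → Fin m}
    (hc : ∀ x ∈ S, ∀ y ∈ S, G.Adj x y → c x ≠ c y) (T : Finset V) (hST : Disjoint S T)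
    (hlt : ∀ v ∈ T, ((S ∪ T).filter (G.Adj v)).card < m) :
    ∃ c' : V → Fin m, (∀ x ∈ S ∪ T, ∀ y ∈ S ∪ T, G.Adj x y → c' x ≠ c' y) ∧
      ∀ x ∈ S, c' x = c x := by
  induction T using Finset.induction_on with
  | empty => exact ⟨c, by simpa using hc, fun _ _ => rfl⟩
  | insert v T hvT ih =>
    rw [disjoint_insert_right] at hST
    obtain ⟨c₁, h₁, h₁'⟩ := ih hST.2 fun w hw =>
      (card_le_card (filter_subset_filter _
        (union_subset_union_right (subset_insert _ _)))).trans_lt (hlt w (mem_insert_of_mem hw))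
    have hv : v ∉ S ∪ T := by simp [hST.1, hvT]
    obtain ⟨c₂, h₂, h₂'⟩ := exists_extend h₁ hv <| card_image_le.trans_lt <|
      (card_le_card (filter_subset_filter _
        (union_subset_union_right (subset_insert _ _)))).trans_lt (hlt v (mem_insert_self _ _))
    refine ⟨c₂, ?_, fun x hx => (h₂' x (mem_union_left _ hx)).trans (h₁' x hx)⟩
    rwa [union_insert]

theorem Critical.le_card_nbrs [DecidableRel G.Adj] {S : Finset V} {m : ℕ} (h : Critical G S m)
    {v : V} (hv : v ∈ S) : m ≤ (S.filter (G.Adj v)).card := by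
  by_contra! hlt
  obtain ⟨c, hc⟩ := h.2 v hv
  obtain ⟨c', hc', -⟩ := exists_extend hc (notMem_erase v S) <| card_image_le.trans_lt <|
    (card_le_card (filter_subset_filter _ (erase_subset _ _))).trans_lt hlt
  rw [insert_erase hv] at hc'
  exact h.1 ⟨c', hc'⟩

/-- A critical set is connected. -/
theorem Critical.eq_of_no_edges {S T : Finset V} {m : ℕ} (h : Critical G S m) (hTS : T ⊆ S)
    (hT : T.Nonempty) (hno : ∀ x ∈ T, ∀ y ∈ S, G.Adj x y → y ∈ T) : T = S := by
  by_contra hne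
  obtain ⟨c₁, h₁⟩ := h.colOn_of_ssubset (hTS.ssubset_of_ne hne)
  obtain ⟨c₂, h₂⟩ := h.colOn_of_ssubset (sdiff_ssubset hTS hT)
  refine h.1 ⟨fun v => if v ∈ T then c₁ v else c₂ v, fun x hx y hy ha => ?_⟩
  by_cases hxT : x ∈ T
  · have hyT := hno x hxT y hy ha
    simpa [hxT, hyT] using h₁ x hxT y hyT ha
  · have hyT : y ∉ T := fun hyT => hxT (hno y hyT x hx ha.symm)
    simpa [hxT, hyT] using h₂ x (mem_sdiff.2 ⟨hx, hxT⟩) y (mem_sdiff.2 ⟨hy, hyT⟩) ha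

/-- A critical set has no cut vertex. -/
theorem Critical.eq_erase_of_no_edges {S T : Finset V} {m : ℕ} (h : Critical G S m) {x : V}
    (hx : x ∈ S) (hTS : T ⊆ S.erase x) (hT : T.Nonempty)
    (hno : ∀ a ∈ T, ∀ b ∈ S.erase x, G.Adj a b → b ∈ T) : T = S.erase x := by
  by_contra hne
  have hxT : x ∉ T := fun hh => (mem_erase.1 (hTS hh)).1 rfl
  have hTS' : T ⊆ S := hTS.trans (erase_subset _ _)
  obtain ⟨y, hy, hyT⟩ := exists_of_ssubset (hTS.ssubset_of_ne hne)
  obtain ⟨c₁, h₁⟩ := h.colOn_of_ssubset (T := insert x T) <| by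
    refine (ssubset_iff_of_subset (insert_subset hx hTS')).2 ⟨y, mem_of_mem_erase hy, ?_⟩
    simp [hyT, (mem_erase.1 hy).1]
  obtain ⟨c₂, h₂⟩ := h.colOn_of_ssubset (sdiff_ssubset hTS' hT)
  -- Permuting the colours of `c₁` makes the two colourings agree at `x`, the only possible contact
  -- between `T` and the rest, so they glue.
  let e := Equiv.swap (c₁ x) (c₂ x)
  have hex : e (c₁ x) = c₂ x := Equiv.swap_apply_left _ _
  have cross : ∀ a ∈ T, ∀ b ∈ S, b ∉ T → G.Adj a b → e (c₁ a) ≠ c₂ b := by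
    intro a ha b hb hbT hab
    have hbx : b = x := by
      by_contra hbx
      exact hbT (hno a ha b (mem_erase.2 ⟨hbx, hb⟩) hab)
    subst hbx
    rw [← hex]
    exact fun hh => h₁ a (mem_insert_of_mem ha) b (mem_insert_self _ _) hab (e.injective hh)
  refine h.1 ⟨fun v => if v ∈ T then e (c₁ v) else c₂ v, fun a ha b hb hab => ?_⟩
  by_cases haT : a ∈ T <;> by_cases hbT : b ∈ T
  · simpa [haT, hbT] using h₁ a (mem_insert_of_mem haT) b (mem_insert_of_mem hbT) hab
  · simpa [haT, hbT] using cross a haT b hb hbT hab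
  · simpa [haT, hbT] using (cross b hbT a ha haT hab.symm).symm
  · simpa [haT, hbT] using h₂ a (mem_sdiff.2 ⟨ha, haT⟩) b (mem_sdiff.2 ⟨hb, hbT⟩) hab

/-- Two sets without edges to the rest of `U`, both obtained from critical sets by deleting a
vertex, coincide as soon as they meet. -/
theorem eq_of_critical_insert {U : V → Prop} {X Y : Finset V} {x y : V} {m m' : ℕ}
    (hX : Critical G (insert x X) m) (hx : x ∉ X) (hY : Critical G (insert y Y) m') (hy : y ∉ Y)
    (hXU : ∀ a ∈ X, U a) (hYU : ∀ a ∈ Y, U a)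
    (hXc : ∀ a ∈ X, ∀ b, U b → G.Adj a b → b ∈ X) (hYc : ∀ a ∈ Y, ∀ b, U b → G.Adj a b → b ∈ Y)
    {z : V} (hzX : z ∈ X) (hzY : z ∈ Y) : X = Y := by
  have hne : (X ∩ Y).Nonempty := ⟨z, mem_inter.2 ⟨hzX, hzY⟩⟩
  have h1 := hX.eq_erase_of_no_edges (mem_insert_self x X) (T := X ∩ Y)
    (by rw [erase_insert hx]; exact inter_subset_left) hne (by
      rw [erase_insert hx]
      intro a ha b hb hab
      exact mem_inter.2 ⟨hb, hYc a (mem_inter.1 ha).2 b (hXU b hb) hab⟩)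
  have h2 := hY.eq_erase_of_no_edges (mem_insert_self y Y) (T := X ∩ Y)
    (by rw [erase_insert hy]; exact inter_subset_right) hne (by
      rw [erase_insert hy]
      intro a ha b hb hab
      exact mem_inter.2 ⟨hXc a (mem_inter.1 ha).1 b (hYU b hb) hab, hb⟩)
  rw [erase_insert hx] at h1
  rw [erase_insert hy] at h2
  exact h1.symm.trans h2

end Critical

/-! ### Two-sided partitions of minimum potential -/

section Partition

variable {V : Type*} [Fintype V] [DecidableEq V] {G : SimpleGraph V} [DecidableRel G.Adj]

/-- The setting of the main argument: an `n`-critical graph whose degrees are at most `n + 1`, in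
which the vertices of degree `n + 1` are independent, and a splitting of the `n` colours. -/
structure Setting (G : SimpleGraph V) [DecidableRel G.Adj] (n : ℕ) (r : Bool → ℕ) : Prop where
  critical : Critical G univ n
  degree_le : ∀ v, G.degree v ≤ n + 1
  low_of_adj : ∀ v w, G.Adj v w → G.degree v = n ∨ G.degree w = n
  add_not : ∀ b, r b + r (!b) = n
  two_le : ∀ b, 2 ≤ r b

/-- The number of neighbours of `v` on side `b`. -/
def sideDegree (G : SimpleGraph V) [DecidableRel G.Adj] (σ : V → Bool) (b : Bool) (v : V) : ℕ :=
  (univ.filter fun w => G.Adj v w ∧ σ w = b).card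

theorem sideDegree_add_not (σ : V → Bool) (b : Bool) (v : V) :
    sideDegree G σ b v + sideDegree G σ (!b) v = G.degree v := by
  have h := card_filter_add_card_filter_not (s := univ.filter (G.Adj v)) (fun w => σ w = b)
  rw [filter_filter, filter_filter] at h
  rw [← G.card_neighborFinset_eq_degree, G.neighborFinset_eq_filter, ← h]
  unfold sideDegree
  congr 3
  ext w
  cases σ w <;> cases b <;> simp

/-- Move the vertex `x` to the other side. -/
def flip (σ : V → Bool) (x : V) : V → Bool := Function.update σ x (!σ x)

@[simp] theorem flip_self (σ : V → Bool) (x : V) : flip σ x x = !σ x := Function.update_self _ _ _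

theorem flip_of_ne (σ : V → Bool) {x y : V} (h : y ≠ x) : flip σ x y = σ y :=
  Function.update_of_ne h _ _

@[simp] theorem flip_flip (σ : V → Bool) (x : V) : flip (flip σ x) x = σ := by
  ext y
  by_cases h : y = x
  · subst h; simp
  · rw [flip_of_ne _ h, flip_of_ne _ h]

/-- Twice the number of edges inside the sides, minus twice the total weight of the sides. -/
def potential (G : SimpleGraph V) [DecidableRel G.Adj] (r : Bool → ℕ) (σ : V → Bool) : ℤ :=
  (∑ v, ∑ w, if G.Adj v w ∧ σ w = σ v then 1 else 0) - 2 * ∑ v, (r (σ v) : ℤ)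

theorem sum_sum_eq_of_symm (g : V → V → ℤ) (hs : ∀ v w, g v w = g w v) (x : V) (h0 : g x x = 0) :
    ∑ v, ∑ w, g v w = 2 * ∑ w, g x w + ∑ v ∈ univ.erase x, ∑ w ∈ univ.erase x, g v w := by
  have h1 : ∀ v, ∑ w, g v w = g x v + ∑ w ∈ univ.erase x, g v w := fun v => by
    rw [← add_sum_erase univ _ (mem_univ x), hs v x]
  rw [← add_sum_erase univ _ (mem_univ x), sum_congr rfl (fun v _ => h1 v), sum_add_distrib,
    ← add_sum_erase univ (g x) (mem_univ x), h0]
  ring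

theorem potential_flip (r : Bool → ℕ) (σ : V → Bool) (x : V) :
    potential G r (flip σ x) - potential G r σ =
      2 * ((sideDegree G σ (!σ x) x - r (!σ x) : ℤ) - (sideDegree G σ (σ x) x - r (σ x))) := by
  have key : ∀ τ : V → Bool, (∑ v, ∑ w, if G.Adj v w ∧ τ w = τ v then (1 : ℤ) else 0) =
      2 * (sideDegree G τ (τ x) x : ℤ) + ∑ v ∈ univ.erase x, ∑ w ∈ univ.erase x,
        if G.Adj v w ∧ τ w = τ v then (1 : ℤ) else 0 := fun τ => by
    rw [sum_sum_eq_of_symm _ (fun v w => by simp [G.adj_comm v w, eq_comm]) x (by simp)]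
    simp [sideDegree]
  have hrest : (∑ v ∈ univ.erase x, ∑ w ∈ univ.erase x,
        if G.Adj v w ∧ flip σ x w = flip σ x v then (1 : ℤ) else 0) =
      ∑ v ∈ univ.erase x, ∑ w ∈ univ.erase x, if G.Adj v w ∧ σ w = σ v then (1 : ℤ) else 0 :=
    sum_congr rfl fun v hv => sum_congr rfl fun w hw => by
      rw [flip_of_ne σ (ne_of_mem_erase hv), flip_of_ne σ (ne_of_mem_erase hw)]
  have hw : ∑ v ∈ univ.erase x, (r (flip σ x v) : ℤ) = ∑ v ∈ univ.erase x, (r (σ v) : ℤ) :=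
    sum_congr rfl fun v hv => by rw [flip_of_ne σ (ne_of_mem_erase hv)]
  have hd : sideDegree G (flip σ x) (!σ x) x = sideDegree G σ (!σ x) x := by
    unfold sideDegree
    congr 1
    refine filter_congr fun w _ => and_congr_right fun h => ?_
    rw [flip_of_ne σ h.ne']
  unfold potential
  rw [key, key, hrest, ← add_sum_erase univ (fun v => (r (flip σ x v) : ℤ)) (mem_univ x),
    ← add_sum_erase univ (fun v => (r (σ v) : ℤ)) (mem_univ x), hw, flip_self, hd]
  ring

/-- `A` is a critical set inside one side of the partition. -/
def CritIn (G : SimpleGraph V) (r : Bool → ℕ) (σ : V → Bool) (A : Finset V) : Prop :=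
  ∃ b, (∀ v ∈ A, σ v = b) ∧ Critical G A (r b)

theorem CritIn.critical {r : Bool → ℕ} {σ : V → Bool} {A : Finset V} (h : CritIn G r σ A) {v : V}
    (hv : v ∈ A) : Critical G A (r (σ v)) := by
  obtain ⟨b, hb, hc⟩ := h
  rwa [hb v hv]

theorem CritIn.side_eq {r : Bool → ℕ} {σ : V → Bool} {A : Finset V} (h : CritIn G r σ A) {v w : V}
    (hv : v ∈ A) (hw : w ∈ A) : σ v = σ w := by
  obtain ⟨b, hb, -⟩ := h
  rw [hb v hv, hb w hw]

theorem critIn_flip_iff {r : Bool → ℕ} {σ : V → Bool} {A : Finset V} {x : V} (hx : x ∉ A) :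
    CritIn G r (flip σ x) A ↔ CritIn G r σ A := by
  refine exists_congr fun b => and_congr_left fun _ => forall₂_congr fun v hv => ?_
  rw [flip_of_ne σ (ne_of_mem_of_not_mem hv hx)]

def IsMin (G : SimpleGraph V) [DecidableRel G.Adj] (r : Bool → ℕ) (σ : V → Bool) : Prop :=
  ∀ τ, potential G r σ ≤ potential G r τ

open Classical in
noncomputable def critSets (G : SimpleGraph V) (r : Bool → ℕ) (σ : V → Bool) :
    Finset (Finset V) :=
  univ.filter (CritIn G r σ)

theorem mem_critSets {r : Bool → ℕ} {σ : V → Bool} {A : Finset V} :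
    A ∈ critSets G r σ ↔ CritIn G r σ A := by simp [critSets]

/-- A partition of minimum potential and, among these, with as few critical sets as possible. -/
def Good (G : SimpleGraph V) [DecidableRel G.Adj] (r : Bool → ℕ) (σ : V → Bool) : Prop :=
  IsMin G r σ ∧ ∀ τ, IsMin G r τ → (critSets G r σ).card ≤ (critSets G r τ).card

theorem exists_good (r : Bool → ℕ) : ∃ σ, Good G r σ := by
  classical
  obtain ⟨σ₀, -, h₀⟩ := exists_min_image (univ : Finset (V → Bool)) (potential G r)
    univ_nonempty
  obtain ⟨σ, hσ, h⟩ := exists_min_image ((univ : Finset (V → Bool)).filter (IsMin G r))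
    (fun σ => (critSets G r σ).card) ⟨σ₀, mem_filter.2 ⟨mem_univ _, fun τ => h₀ τ (mem_univ _)⟩⟩
  exact ⟨σ, (mem_filter.1 hσ).2, fun τ hτ => h τ (mem_filter.2 ⟨mem_univ _, hτ⟩)⟩

variable {n : ℕ} {r : Bool → ℕ} {σ : V → Bool} {A : Finset V}

/-- By minimality the excess of `v` over `r` on its own side is at most the excess on the other
side. The two excesses add up to at most 1, so by integrality the first is not positive. -/
theorem Setting.sideDegree_le (hG : Setting G n r) (hσ : IsMin G r σ) (v : V) :
    sideDegree G σ (σ v) v ≤ r (σ v) := by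
  have h1 := potential_flip (G := G) r σ v
  have h2 := hσ (flip σ v)
  have h3 := sideDegree_add_not (G := G) σ (σ v) v
  have h4 := hG.degree_le v
  have h5 := hG.add_not (σ v)
  omega

/-- Criticality bounds the degree in `A` below by the same number that bounds the degree in the side
above. Hence `A` is a regular component of its side. -/
theorem Setting.filter_eq (hG : Setting G n r) (hσ : IsMin G r σ) (hA : CritIn G r σ A) {v : V}
    (hv : v ∈ A) : A.filter (G.Adj v) = univ.filter fun w => G.Adj v w ∧ σ w = σ v := by
  refine eq_of_subset_of_card_le (fun w hw => ?_) ?_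
  · obtain ⟨hw, ha⟩ := mem_filter.1 hw
    simp [ha, hA.side_eq hw hv]
  · exact (hG.sideDegree_le hσ v).trans ((hA.critical hv).le_card_nbrs hv)

theorem Setting.mem_of_adj (hG : Setting G n r) (hσ : IsMin G r σ) (hA : CritIn G r σ A) {v w : V}
    (hv : v ∈ A) (ha : G.Adj v w) (hw : σ w = σ v) : w ∈ A := by
  have : w ∈ A.filter (G.Adj v) := by
    rw [hG.filter_eq hσ hA hv]
    simp [ha, hw]
  exact (mem_filter.1 this).1

theorem Setting.card_nbrs (hG : Setting G n r) (hσ : IsMin G r σ) (hA : CritIn G r σ A) {v : V}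
    (hv : v ∈ A) : (A.filter (G.Adj v)).card = r (σ v) := by
  refine le_antisymm ?_ ((hA.critical hv).le_card_nbrs hv)
  rw [hG.filter_eq hσ hA hv]
  exact hG.sideDegree_le hσ v

theorem Setting.critIn_unique (hG : Setting G n r) (hσ : IsMin G r σ) (hA : CritIn G r σ A)
    {B : Finset V} (hB : CritIn G r σ B) {v : V} (hvA : v ∈ A) (hvB : v ∈ B) : A = B := by
  have hne : (A ∩ B).Nonempty := ⟨v, mem_inter.2 ⟨hvA, hvB⟩⟩
  have h1 := (hA.critical hvA).eq_of_no_edges inter_subset_left hne fun x hx y hy ha =>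
    mem_inter.2 ⟨hy, hG.mem_of_adj hσ hB (mem_inter.1 hx).2 ha
      (hA.side_eq hy (mem_inter.1 hx).1)⟩
  have h2 := (hB.critical hvB).eq_of_no_edges inter_subset_right hne fun x hx y hy ha =>
    mem_inter.2 ⟨hG.mem_of_adj hσ hA (mem_inter.1 hx).1 ha
      (hB.side_eq hy (mem_inter.1 hx).2), hy⟩
  exact h1.symm.trans h2

/-- A low vertex of a critical set has excess 0 over `r` on both sides, so moving it leaves the
potential unchanged. -/
theorem Setting.isMin_flip (hG : Setting G n r) (hσ : IsMin G r σ) (hA : CritIn G r σ A) {x : V}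
    (hx : x ∈ A) (hlow : G.degree x = n) : IsMin G r (flip σ x) := by
  have h0 : sideDegree G σ (σ x) x = r (σ x) := by
    rw [← hG.card_nbrs hσ hA hx, hG.filter_eq hσ hA hx, sideDegree]
  have h1 := potential_flip (G := G) r σ x
  have h3 := sideDegree_add_not (G := G) σ (σ x) x
  have h5 := hG.add_not (σ x)
  intro τ
  have := hσ τ
  omega

/-- Moving a vertex of degree `n` out of a critical set creates a critical set on the other side,
and the partition remains good. -/
theorem Setting.good_flip (hG : Setting G n r) (hσ : Good G r σ) (hA : CritIn G r σ A) {x : V}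
    (hx : x ∈ A) (hlow : G.degree x = n) :
    Good G r (flip σ x) ∧ ∃ F, CritIn G r (flip σ x) F ∧ x ∈ F := by
  have hmin := hG.isMin_flip hσ.1 hA hx hlow
  have hAσ : A ∈ critSets G r σ := mem_critSets.2 hA
  constructor
  · refine ⟨hmin, fun τ hτ => le_trans ?_ (hσ.2 τ hτ)⟩
    by_cases hF : ∃ F, CritIn G r (flip σ x) F ∧ x ∈ F
    · obtain ⟨F, hF, hxF⟩ := hF
      have hFσ : F ∈ critSets G r (flip σ x) := mem_critSets.2 hF
      -- The move destroys `A` and creates at most `F`: a critical set avoiding `x` is unaffected.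
      have hsub : (critSets G r (flip σ x)).erase F ⊆ (critSets G r σ).erase A := by
        intro S hS
        obtain ⟨hne, hS⟩ := mem_erase.1 hS
        have hS := mem_critSets.1 hS
        have hxS : x ∉ S := fun hxS => hne (hG.critIn_unique hmin hS hF hxS hxF)
        exact mem_erase.2 ⟨fun e => hxS (e ▸ hx), mem_critSets.2 ((critIn_flip_iff hxS).1 hS)⟩
      have := card_le_card hsub
      rw [card_erase_of_mem hFσ, card_erase_of_mem hAσ] at this
      have := card_pos.2 ⟨A, hAσ⟩
      omega
    · refine card_le_card fun S hS => ?_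
      have hS := mem_critSets.1 hS
      exact mem_critSets.2 ((critIn_flip_iff fun hxS => hF ⟨S, hS, hxS⟩).1 hS)
  · by_contra hF
    have hsub : critSets G r (flip σ x) ⊆ (critSets G r σ).erase A := by
      intro S hS
      have hS := mem_critSets.1 hS
      have hxS : x ∉ S := fun hxS => hF ⟨S, hS, hxS⟩
      exact mem_erase.2 ⟨fun e => hxS (e ▸ hx), mem_critSets.2 ((critIn_flip_iff hxS).1 hS)⟩
    have h1 := card_le_card hsub
    have h2 := hσ.2 _ hmin
    rw [card_erase_of_mem hAσ] at h1
    have := card_pos.2 ⟨A, hAσ⟩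
    omega

/-- Otherwise both sides could be coloured, with disjoint palettes of total size `n`. -/
theorem Setting.exists_critIn (hG : Setting G n r) (σ : V → Bool) : ∃ A, CritIn G r σ A := by
  by_contra! h
  have hcol : ∀ b, ColOn G (univ.filter fun v => σ v = b) (r b) := by
    intro b
    by_contra hb
    obtain ⟨T, hT, hc⟩ := exists_critical hb
    exact h T ⟨b, fun v hv => (mem_filter.1 (hT hv)).2, hc⟩
  choose c hc using hcol
  have hn : r false + r true = n := hG.add_not false
  refine hG.critical.1 ⟨fun v => Fin.cast hn (if σ v then Fin.natAdd _ (c true v)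
    else Fin.castAdd _ (c false v)), fun x _ y _ ha he => ?_⟩
  have hs : ∀ b, σ x = b → σ y = b → c b x ≠ c b y := fun b hx hy =>
    hc b x (by simp [hx]) y (by simp [hy]) ha
  have h1 := (c false x).2
  have h2 := (c false y).2
  rw [Fin.ext_iff] at he
  cases hx : σ x <;> cases hy : σ y <;> simp [hx, hy] at he
  · exact hs _ hx hy (Fin.ext he)
  · omega
  · omega
  · exact hs _ hx hy (Fin.ext he)

/-- A critical set contains two adjacent vertices of degree `n`. -/
theorem Setting.exists_low_pair (hG : Setting G n r) (hA : CritIn G r σ A) :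
    ∃ p ∈ A, ∃ q ∈ A, G.Adj p q ∧ G.degree p = n ∧ G.degree q = n := by
  obtain ⟨b, -, hc⟩ := hA
  by_contra! h
  have h2 := hG.two_le b
  -- If low vertices were independent too, low/high would be a proper 2-colouring; this uses `2 ≤ r
  -- b`.
  refine hc.1 ⟨fun v => if G.degree v = n then ⟨0, by omega⟩ else ⟨1, by omega⟩,
    fun x hx y hy ha => ?_⟩
  have h1 := hG.low_of_adj x y ha
  have h3 := h x hx y hy ha
  by_cases hdx : G.degree x = n <;> by_cases hdy : G.degree y = n <;> simp_all

end Partition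

/-! ### The walk of moved vertices and its first return -/

section Walk

variable {V : Type*} [Fintype V] [DecidableEq V] {G : SimpleGraph V} [DecidableRel G.Adj]
variable {n : ℕ} {r : Bool → ℕ} {σ : V → Bool} {A B C : Finset V} {p q t : V}

theorem Setting.erase_closed (hG : Setting G n r) {x : V} (hσ : IsMin G r (flip σ x))
    (hA : CritIn G r (flip σ x) A) (hx : x ∈ A) {a : V} (ha : a ∈ A.erase x) :
    σ a = (!σ x) ∧ ∀ b, σ b = (!σ x) → G.Adj a b → b ∈ A.erase x := by
  obtain ⟨hax, haA⟩ := mem_erase.1 ha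
  have h := hA.side_eq haA hx
  rw [flip_self, flip_of_ne _ hax] at h
  refine ⟨h, fun b hb hab => ?_⟩
  have hbx : b ≠ x := by rintro rfl; simp at hb
  refine mem_erase.2 ⟨hbx, hG.mem_of_adj hσ hA haA hab ?_⟩
  rw [flip_of_ne _ hbx, flip_of_ne _ hax, hb, h]

/-- Two vertices on the same side which, when moved, create critical sets that share a further
vertex attach to the same set. -/
theorem Setting.erase_eq_erase (hG : Setting G n r) {x y : V} (hσx : IsMin G r (flip σ x))
    (hσy : IsMin G r (flip σ y)) (hxy : σ x = σ y) (hA : CritIn G r (flip σ x) A) (hx : x ∈ A)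
    (hB : CritIn G r (flip σ y) B) (hy : y ∈ B) {z : V} (hzA : z ∈ A) (hzB : z ∈ B) (hzx : z ≠ x)
    (hzy : z ≠ y) : A.erase x = B.erase y := by
  refine eq_of_critical_insert (U := fun w => σ w = !σ x) (x := x) (y := y)
    (m := r (flip σ x x)) (m' := r (flip σ y y)) ?_ (notMem_erase _ _) ?_ (notMem_erase _ _)
    (fun a ha => (hG.erase_closed hσx hA hx ha).1)
    (fun a ha => ?_) (fun a ha => (hG.erase_closed hσx hA hx ha).2) (fun a ha => ?_)
    (mem_erase.2 ⟨hzx, hzA⟩) (mem_erase.2 ⟨hzy, hzB⟩)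
  · rw [insert_erase hx]; exact hA.critical hx
  · rw [insert_erase hy]; exact hB.critical hy
  · rw [hxy]; exact (hG.erase_closed hσy hB hy ha).1
  · rw [hxy]; exact (hG.erase_closed hσy hB hy ha).2

/-- Used when two vertices complete the same set `D` to regular sets of equal degree: they then have
the same neighbours in `D`. -/
theorem adj_iff_of_card_eq {D : Finset V} {x y a : V} (hx : x ∉ D) (hy : y ∉ D)
    (h : ((insert x D).filter (G.Adj a)).card = ((insert y D).filter (G.Adj a)).card) :
    G.Adj a x ↔ G.Adj a y := by
  rw [filter_insert, filter_insert] at h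
  split_ifs at h with h1 h2 h2
  · exact iff_of_true h1 h2
  · rw [card_insert_of_notMem (by simp [hx])] at h; omega
  · rw [card_insert_of_notMem (by simp [hy])] at h; omega
  · exact iff_of_false h1 h2

/-- Two adjacent vertices `p`, `q` of degree `n` in a critical set `A` which, when moved, attach to
the same set `C`, together with a neighbour `t` of `q` in `C` of degree `n`. -/
structure Linked (G : SimpleGraph V) [DecidableRel G.Adj] (n : ℕ) (r : Bool → ℕ) (σ : V → Bool)
    (A C : Finset V) (p q t : V) : Prop where
  good : Good G r σ
  crit : CritIn G r σ A
  hp : p ∈ A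
  hq : q ∈ A
  adj : G.Adj p q
  low_p : G.degree p = n
  low_q : G.degree q = n
  crit_p : CritIn G r (flip σ p) (insert p C)
  crit_q : CritIn G r (flip σ q) (insert q C)
  p_notMem : p ∉ C
  q_notMem : q ∉ C
  ht : t ∈ C
  low_t : G.degree t = n
  adj_t : G.Adj q t

/-- A good partition with a critical set and an edge `pq` in it joining vertices of degree `n`. -/
structure Stage (G : SimpleGraph V) [DecidableRel G.Adj] (n : ℕ) (r : Bool → ℕ) where
  σ : V → Bool
  A : Finset V
  p : V
  q : V
  good : Good G r σ
  crit : CritIn G r σ A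
  hp : p ∈ A
  hq : q ∈ A
  adj : G.Adj p q
  low_p : G.degree p = n
  low_q : G.degree q = n

theorem Setting.exists_stage (hG : Setting G n r) : Nonempty (Stage G n r) := by
  obtain ⟨σ, hσ⟩ := exists_good (G := G) r
  obtain ⟨A, hA⟩ := hG.exists_critIn σ
  obtain ⟨p, hp, q, hq, h1, h2, h3⟩ := hG.exists_low_pair hA
  exact ⟨⟨σ, A, p, q, hσ, hA, hp, hq, h1, h2, h3⟩⟩

/-- The low edge may be oriented so that its `q` differs from the vertex just moved, which therefore
stays behind at the next move. -/
theorem Setting.exists_next (hG : Setting G n r) (s : Stage G n r) :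
    ∃ s' : Stage G n r, s'.σ = flip s.σ s.q ∧ s.q ∈ s'.A ∧ s'.q ≠ s.q := by
  obtain ⟨hgood, F, hF, hqF⟩ := hG.good_flip s.good s.crit s.hq s.low_q
  obtain ⟨p, hp, q, hq, h1, h2, h3⟩ := hG.exists_low_pair hF
  by_cases h : q = s.q
  · exact ⟨⟨_, F, q, p, hgood, hF, hq, hp, h1.symm, h3, h2⟩, rfl, hqF, fun e => h1.ne (e.trans h.symm)⟩
  · exact ⟨⟨_, F, p, q, hgood, hF, hp, hq, h1, h2, h3⟩, rfl, hqF, h⟩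

/-- The vertices that stay behind when `q` is moved. -/
def Stage.rest (s : Stage G n r) : Finset V := s.A.erase s.q

theorem Stage.p_mem_rest (s : Stage G n r) : s.p ∈ s.rest := mem_erase.2 ⟨s.adj.ne, s.hp⟩

section Sequence

variable {S : ℕ → Stage G n r} (hS : ∀ i, (S (i + 1)).σ = flip (S i).σ (S i).q)
  (hA : ∀ i, (S i).q ∈ (S (i + 1)).A) (hq : ∀ i, (S (i + 1)).q ≠ (S i).q)

include hS in
-- A vertex left behind could change sides only as some later `q`, which lies in the current
-- critical set; `hk` excludes this.
theorem side_static {k : ℕ} (hk : ∀ j ≤ k, ∀ i < j, ∀ x ∈ (S i).rest, x ∉ (S j).A) {j : ℕ} {x : V}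
    (hx : x ∈ (S j).rest) {i : ℕ} (hji : j ≤ i) (hik : i ≤ k + 1) : (S i).σ x = (S j).σ x := by
  induction i, hji using Nat.le_induction with
  | base => rfl
  | succ i hji ih =>
    rw [hS, flip_of_ne, ih (by omega)]
    rintro rfl
    rcases hji.eq_or_lt with rfl | hlt
    · exact notMem_erase _ _ hx
    · exact hk i (by omega) j hlt _ hx (S i).hq

include hA hq in
theorem q_mem_rest (i : ℕ) : (S i).q ∈ (S (i + 1)).rest := mem_erase.2 ⟨(hq i).symm, hA i⟩

include hS hA hq in
-- If `w` has not moved since stage `j`, it was already in the component `A` of that stage. If `w`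
-- is some earlier `q`, then on arrival it had `x` as a neighbour on its side, so the walk would
-- have returned to `x` too early.
theorem rest_closed (hG : Setting G n r) {k : ℕ}
    (hk : ∀ j ≤ k, ∀ i < j, ∀ x ∈ (S i).rest, x ∉ (S j).A) {j : ℕ} (hj : j ≤ k) {x w : V}
    (hx : x ∈ (S j).rest) (hw : w ≠ (S k).q) (hxw : G.Adj x w)
    (hside : (S (k + 1)).σ w = (S (k + 1)).σ x) : w ∈ (S j).rest := by
  have hx' : (S (k + 1)).σ x = (S j).σ x := side_static hS hk hx (by omega) le_rfl
  by_cases h : ∃ i, j ≤ i ∧ i ≤ k ∧ w = (S i).q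
  · exfalso
    obtain ⟨i, hji, hik, rfl⟩ := h
    have hne : i ≠ k := by rintro rfl; exact hw rfl
    have h1 := side_static hS hk (q_mem_rest hA hq i) (i := k + 1) (by omega) le_rfl
    have h2 := side_static hS hk hx (i := i + 1) (by omega) (by omega)
    refine hk (i + 1) (by omega) j (by omega) x hx
      (hG.mem_of_adj (S (i + 1)).good.1 (S (i + 1)).crit (hA i) hxw.symm ?_)
    rw [h2, ← hx', ← hside, h1]
  · push Not at h
    have key : ∀ i, j ≤ i → i ≤ k + 1 → (S i).σ w = (S j).σ w := by
      intro i hji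
      induction i, hji using Nat.le_induction with
      | base => exact fun _ => rfl
      | succ i hji ih =>
        intro hik
        rw [hS, flip_of_ne _ (h i hji (by omega)), ih (by omega)]
    refine mem_erase.2 ⟨h j le_rfl hj, hG.mem_of_adj (S j).good.1 (S j).crit
      (mem_of_mem_erase hx) hxw ?_⟩
    rw [← key (k + 1) (by omega) le_rfl, hside, hx']

include hS hA hq in
/-- If the walk returns to a set visited before, then two vertices attach to the same set. -/
theorem exists_linked_of_return (hG : Setting G n r) {k : ℕ}
    (hk : ∀ j ≤ k, ∀ i < j, ∀ x ∈ (S i).rest, x ∉ (S j).A) {j : ℕ} (hj : j ≤ k) {x : V}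
    (hx : x ∈ (S j).rest) (hxA : x ∈ (S (k + 1)).A) :
    ∃ σ A C p q t, Linked G n r σ A C p q t := by
  have hx' : (S (k + 1)).σ x = (S j).σ x := side_static hS hk hx (by omega) le_rfl
  have hsx : (S (k + 1)).σ x = !(S k).σ (S k).q := by
    rw [(S (k + 1)).crit.side_eq hxA (hA k), hS, flip_self]
  have hlt : j < k := by
    refine lt_of_le_of_ne hj ?_
    rintro rfl
    rw [hx', (S j).crit.side_eq (mem_of_mem_erase hx) (S j).hq] at hsx
    simp at hsx
  have hxk : x ≠ (S k).q := by
    rintro rfl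
    exact hk k le_rfl j hlt _ hx (S k).hq
  have hgood := (S (k + 1)).good
  have hcrit := (S (k + 1)).crit
  have hrest : ∀ i, insert (S i).q (S i).rest = (S i).A := fun i => insert_erase (S i).hq
  have hqn : ∀ i, (S i).q ∉ (S i).rest := fun i => notMem_erase _ _
  -- the critical set at the return
  have hEq : (S (k + 1)).A.erase (S k).q = (S j).rest := by
    rw [hS] at hcrit
    have hmin : IsMin G r (flip (S k).σ (S k).q) := hS k ▸ hgood.1
    refine eq_of_critical_insert (U := fun w => (S k).σ w = !(S k).σ (S k).q) (x := (S k).q)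
      (y := (S j).q) (m := r ((S (k + 1)).σ x)) (m' := r ((S j).σ x)) ?_ (notMem_erase _ _) ?_
      (hqn j) (fun a ha => (hG.erase_closed hmin hcrit (hA k) ha).1) (fun a ha => ?_)
      (fun a ha => (hG.erase_closed hmin hcrit (hA k) ha).2) (fun a ha b hb hab => ?_)
      (mem_erase.2 ⟨hxk, hxA⟩) hx
    · rw [insert_erase (hA k)]; exact (S (k + 1)).crit.critical hxA
    · rw [hrest]; exact (S j).crit.critical (mem_of_mem_erase hx)
    · rw [side_static hS hk ha hj (by omega), (S j).crit.side_eq (mem_of_mem_erase ha)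
        (mem_of_mem_erase hx), ← hx', hsx]
    · have hbq : b ≠ (S k).q := by rintro rfl; simp at hb
      refine rest_closed hS hA hq hG hk hj ha hbq hab ?_
      rw [hS, flip_of_ne _ hbq, hb, ← hS, side_static hS hk ha (by omega) le_rfl,
        (S j).crit.side_eq (mem_of_mem_erase ha) (mem_of_mem_erase hx), ← hx', hsx]
  have hpj := (S j).p_mem_rest
  have hpA : (S j).p ∈ (S (k + 1)).A := mem_of_mem_erase (hEq ▸ hpj)
  obtain ⟨hgood', F, hF, hpF⟩ := hG.good_flip hgood hcrit hpA (S j).low_p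
  have hqj := q_mem_rest hA hq j
  have hqp : (S j).q ≠ (S j).p := (S j).adj.ne'
  have hpσ : (S (k + 1)).σ (S j).p = (S j).σ (S j).p := side_static hS hk hpj (by omega) le_rfl
  have hjq1 : (S (j + 1)).σ (S j).q = !(S j).σ (S j).p := by
    rw [hS, flip_self, (S j).crit.side_eq (S j).hq (S j).hp]
  have hqσ : (S (k + 1)).σ (S j).q = !(S j).σ (S j).p := by
    rw [side_static hS hk hqj (by omega) le_rfl, hjq1]
  have hqF : (S j).q ∈ F := hG.mem_of_adj hgood'.1 hF hpF (S j).adj <| by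
    rw [flip_self, flip_of_ne _ hqp, hqσ, hpσ]
  have hside1 : ∀ a ∈ (S (j + 1)).A, (S (j + 1)).σ a = !(S j).σ (S j).p := fun a ha => by
    rw [(S (j + 1)).crit.side_eq ha (hA j), hjq1]
  -- After the return, the old `p` attaches through its neighbour `q` to what was left behind at
  -- stage `j + 1`, taking the place of the departed `(S (j + 1)).q`.
  have hEq2 : F.erase (S j).p = (S (j + 1)).rest := by
    refine eq_of_critical_insert (U := fun w => (S (k + 1)).σ w = !(S (k + 1)).σ (S j).p)
      (x := (S j).p) (y := (S (j + 1)).q) (m := r (flip (S (k + 1)).σ (S j).p (S j).p))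
      (m' := r ((S (j + 1)).σ (S (j + 1)).q)) ?_ (notMem_erase _ _) ?_
      (hqn _) (fun a ha => (hG.erase_closed hgood'.1 hF hpF ha).1) (fun a ha => ?_)
      (fun a ha => (hG.erase_closed hgood'.1 hF hpF ha).2) (fun a ha b hb hab => ?_)
      (mem_erase.2 ⟨hqp, hqF⟩) hqj
    · rw [insert_erase hpF]; exact hF.critical hpF
    · rw [hrest]; exact (S (j + 1)).crit.critical (S (j + 1)).hq
    · rw [side_static hS hk ha (by omega) le_rfl, hside1 a (mem_of_mem_erase ha), hpσ]
    · refine rest_closed hS hA hq hG hk (by omega) ha ?_ hab ?_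
      · rintro rfl
        rw [hcrit.side_eq (hA k) hpA] at hb
        simp at hb
      · rw [hb, side_static hS hk ha (by omega) le_rfl, hside1 a (mem_of_mem_erase ha), hpσ]
  -- a second neighbour of `p` in the next set
  obtain ⟨e, he, heq⟩ : ∃ e ∈ F.filter (G.Adj (S j).p), e ≠ (S j).q := by
    refine exists_mem_ne ?_ _
    rw [hG.card_nbrs hgood'.1 hF hpF]
    exact hG.two_le _
  obtain ⟨heF, hpe⟩ := mem_filter.1 he
  have heR : e ∈ (S (j + 1)).rest := hEq2 ▸ mem_erase.2 ⟨hpe.ne', heF⟩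
  obtain ⟨hg1, F', hF', hpF'⟩ := hG.good_flip (S j).good (S j).crit (S j).hp (S j).low_p
  have heσ : (S j).σ e = !(S j).σ (S j).p := by
    rw [← hside1 e (mem_of_mem_erase heR), hS, flip_of_ne _ heq]
  have heF' : e ∈ F' := hG.mem_of_adj hg1.1 hF' hpF' hpe <| by
    rw [flip_self, flip_of_ne _ hpe.ne', heσ]
  have hmin1 : IsMin G r (flip (S j).σ (S j).q) := hS j ▸ (S (j + 1)).good.1
  have hcrit1 : CritIn G r (flip (S j).σ (S j).q) (S (j + 1)).A := hS j ▸ (S (j + 1)).crit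
  -- Back at stage `j`, the common vertex `e` shows that `p` and `q` attach to the same set.
  have hEq3 : F'.erase (S j).p = (S (j + 1)).A.erase (S j).q :=
    hG.erase_eq_erase hg1.1 hmin1 ((S j).crit.side_eq (S j).hp (S j).hq) hF' hpF' hcrit1 (hA j)
      heF' (mem_of_mem_erase heR) hpe.ne' heq
  -- Both `p` and the next `q` complete `(S (j + 1)).rest` to a regular set, so `q`, adjacent to the
  -- former, is adjacent to the latter.
  have hadj : G.Adj (S j).q (S (j + 1)).q := by
    refine (adj_iff_of_card_eq (D := (S (j + 1)).rest) (x := (S j).p) ?_ (hqn _) ?_).1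
      (S j).adj.symm
    · rw [← hEq2]; exact notMem_erase _ _
    · rw [hrest, ← hEq2, insert_erase hpF, hG.card_nbrs hgood'.1 hF hqF,
        hG.card_nbrs (S (j + 1)).good.1 (S (j + 1)).crit (hA j), hjq1, flip_of_ne _ hqp, hqσ]
  exact ⟨(S j).σ, (S j).A, (S (j + 1)).A.erase (S j).q, (S j).p, (S j).q, (S (j + 1)).q,
    { good := (S j).good
      crit := (S j).crit
      hp := (S j).hp
      hq := (S j).hq
      adj := (S j).adj
      low_p := (S j).low_p
      low_q := (S j).low_q
      crit_p := by rw [← hEq3, insert_erase hpF']; exact hF'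
      crit_q := by rw [insert_erase (hA j)]; exact hcrit1
      p_notMem := by rw [← hEq3]; exact notMem_erase _ _
      q_notMem := notMem_erase _ _
      ht := mem_erase.2 ⟨hq j, (S (j + 1)).hq⟩
      low_t := (S (j + 1)).low_q
      adj_t := hadj }⟩

end Sequence

theorem Setting.exists_linked (hG : Setting G n r) :
    ∃ σ A C p q t, Linked G n r σ A C p q t := by
  obtain ⟨s₀⟩ := hG.exists_stage
  choose f hf using hG.exists_next
  let S : ℕ → Stage G n r := fun i => f^[i] s₀
  have hSf : ∀ i, S (i + 1) = f (S i) := fun i => Function.iterate_succ_apply' f i s₀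
  have hS : ∀ i, (S (i + 1)).σ = flip (S i).σ (S i).q := fun i => hSf i ▸ (hf (S i)).1
  have hA : ∀ i, (S i).q ∈ (S (i + 1)).A := fun i => hSf i ▸ (hf (S i)).2.1
  have hq : ∀ i, (S (i + 1)).q ≠ (S i).q := fun i => hSf i ▸ (hf (S i)).2.2
  by_contra hno
  have hk : ∀ k, ∀ j ≤ k, ∀ i < j, ∀ x ∈ (S i).rest, x ∉ (S j).A := by
    intro k
    induction k with
    | zero => intro j hj i hi; omega
    | succ k ih =>
      intro j hj i hi x hx hxA
      rcases hj.lt_or_eq with hlt | rfl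
      · exact ih j (by omega) i hi x hx hxA
      · exact hno (exists_linked_of_return hS hA hq hG ih (by omega) hx hxA)
  -- Without a return the vertices `p` of the stages are distinct, which is impossible in a finite
  -- graph.
  have hinj : Function.Injective fun i => (S i).p := by
    have : ∀ i j, i < j → (S i).p ≠ (S j).p := fun i j hij e =>
      hk j j le_rfl i hij _ (S i).p_mem_rest (e ▸ (S j).hp)
    intro i j hij
    rcases lt_trichotomy i j with h | h | h
    · exact absurd hij (this i j h)
    · exact h
    · exact absurd hij.symm (this j i h)
  exact not_injective_infinite_finite _ hinj

end Walk

/-! ### Low neighbours of p share its closed neighbourhood -/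

section Linked

variable {V : Type*} [Fintype V] [DecidableEq V] {G : SimpleGraph V} [DecidableRel G.Adj]
variable {n : ℕ} {r : Bool → ℕ} {σ : V → Bool} {A C : Finset V} {p q t : V}

theorem Linked.good_p (h : Linked G n r σ A C p q t) (hG : Setting G n r) :
    Good G r (flip σ p) := (hG.good_flip h.good h.crit h.hp h.low_p).1

theorem Linked.good_q (h : Linked G n r σ A C p q t) (hG : Setting G n r) :
    Good G r (flip σ q) := (hG.good_flip h.good h.crit h.hq h.low_q).1

theorem Linked.adj_iff (h : Linked G n r σ A C p q t) (hG : Setting G n r) {c : V} (hc : c ∈ C) :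
    G.Adj c p ↔ G.Adj c q := by
  refine adj_iff_of_card_eq h.p_notMem h.q_notMem ?_
  rw [hG.card_nbrs (h.good_p hG).1 h.crit_p (mem_insert_of_mem hc),
    hG.card_nbrs (h.good_q hG).1 h.crit_q (mem_insert_of_mem hc),
    flip_of_ne _ (ne_of_mem_of_not_mem hc h.p_notMem),
    flip_of_ne _ (ne_of_mem_of_not_mem hc h.q_notMem)]

theorem Linked.symm (h : Linked G n r σ A C p q t) (hG : Setting G n r) :
    Linked G n r σ A C q p t where
  good := h.good
  crit := h.crit
  hp := h.hq
  hq := h.hp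
  adj := h.adj.symm
  low_p := h.low_q
  low_q := h.low_p
  crit_p := h.crit_q
  crit_q := h.crit_p
  p_notMem := h.q_notMem
  q_notMem := h.p_notMem
  ht := h.ht
  low_t := h.low_t
  adj_t := ((h.adj_iff hG h.ht).2 h.adj_t.symm).symm

/-- After `p` has moved, moving `t` back and moving `p` back both create critical sets containing
`q`. So `t` takes the place of `p` in `A`. -/
theorem Linked.crit_t (h : Linked G n r σ A C p q t) (hG : Setting G n r) :
    IsMin G r (flip (flip σ p) t) ∧ t ∉ A.erase p ∧
      CritIn G r (flip (flip σ p) t) (insert t (A.erase p)) := by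
  have htm : t ∈ insert p C := mem_insert_of_mem h.ht
  obtain ⟨hg, T, hT, htT⟩ := hG.good_flip (h.good_p hG) h.crit_p htm h.low_t
  have hside := h.crit_p.side_eq htm (mem_insert_self _ _)
  have hqt : q ≠ t := h.adj_t.ne
  have hqp : q ≠ p := h.adj.ne'
  have hqT : q ∈ T := hG.mem_of_adj hg.1 hT htT h.adj_t.symm <| by
    rw [flip_self, flip_of_ne _ hqt, flip_of_ne _ hqp, hside, flip_self, Bool.not_not,
      h.crit.side_eq h.hq h.hp]
  have hE : T.erase t = A.erase p :=
    hG.erase_eq_erase hg.1 (by rw [flip_flip]; exact h.good.1) hside hT htT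
      (by rw [flip_flip]; exact h.crit) h.hp hqT h.hq hqt hqp
  refine ⟨hg.1, ?_, ?_⟩
  · rw [← hE]; exact notMem_erase _ _
  · rw [← hE, insert_erase htT]; exact hT

/-- Interchange of the two sides. -/
theorem Linked.swap (h : Linked G n r σ A C p q t) (hG : Setting G n r) :
    Linked G n r (flip σ p) (insert p C) (A.erase p) t p q where
  good := h.good_p hG
  crit := h.crit_p
  hp := mem_insert_of_mem h.ht
  hq := mem_insert_self _ _
  adj := (h.adj_iff hG h.ht).2 h.adj_t.symm
  low_p := h.low_t
  low_q := h.low_p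
  crit_p := (h.crit_t hG).2.2
  crit_q := by rw [flip_flip, insert_erase h.hp]; exact h.crit
  p_notMem := (h.crit_t hG).2.1
  q_notMem := notMem_erase _ _
  ht := mem_erase.2 ⟨h.adj.ne', h.hq⟩
  low_t := h.low_q
  adj_t := h.adj

theorem Linked.adj_t_iff (h : Linked G n r σ A C p q t) (hG : Setting G n r) {a : V} (ha : a ∈ A)
    (hap : a ≠ p) : G.Adj a t ↔ G.Adj a p := by
  obtain ⟨hmin, htA, hT⟩ := h.crit_t hG
  have haA : a ∈ A.erase p := mem_erase.2 ⟨hap, ha⟩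
  refine adj_iff_of_card_eq htA (notMem_erase p A) ?_
  rw [hG.card_nbrs hmin hT (mem_insert_of_mem haA), insert_erase h.hp,
    hG.card_nbrs h.good.1 h.crit ha, flip_of_ne _ (ne_of_mem_of_not_mem haA htA),
    flip_of_ne _ hap]

theorem Linked.mem_or_mem (h : Linked G n r σ A C p q t) (hG : Setting G n r) {y : V}
    (hy : G.Adj p y) : y ∈ A ∨ y ∈ C := by
  by_cases hs : σ y = σ p
  · exact Or.inl (hG.mem_of_adj h.good.1 h.crit h.hp hy hs)
  · refine Or.inr (mem_of_mem_insert_of_ne (hG.mem_of_adj (h.good_p hG).1 h.crit_p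
      (mem_insert_self _ _) hy ?_) hy.ne')
    rw [flip_self, flip_of_ne _ hy.ne']
    exact Bool.eq_not_of_ne hs

/-- On `C` this is the comparison of `p` with `q`; on `A` the vertex `t` mediates, since it can
replace either of them. -/
theorem Linked.adj_q (h : Linked G n r σ A C p q t) (hG : Setting G n r) {y : V}
    (hy : G.Adj p y) (hyq : y ≠ q) : G.Adj q y := by
  rcases h.mem_or_mem hG hy with hyA | hyC
  · exact (((h.symm hG).adj_t_iff hG hyA hyq).1 ((h.adj_t_iff hG hyA hy.ne').2 hy.symm)).symm
  · exact ((h.adj_iff hG hyC).1 hy.symm).symm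

theorem Linked.adj_t' (h : Linked G n r σ A C p q t) (hG : Setting G n r) {y : V}
    (hy : G.Adj p y) (hyt : y ≠ t) : G.Adj t y := by
  rcases h.mem_or_mem hG hy with hyA | hyC
  · exact ((h.adj_t_iff hG hyA hy.ne').2 hy.symm).symm
  · exact ((h.swap hG).symm hG).adj_q hG hy hyt

/-- When moved, any low neighbour `x` of `p` in `A` meets `t`, hence attaches to the same set `C`.
With `Linked.replace_t` this makes the role of `q` or `t` available to every low neighbour of `p`.
-/
theorem Linked.replace_q (h : Linked G n r σ A C p q t) (hG : Setting G n r) {x : V} (hx : x ∈ A)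
    (hpx : G.Adj p x) (hlow : G.degree x = n) : Linked G n r σ A C p x t := by
  have hxt : G.Adj x t := (h.adj_t_iff hG hx hpx.ne').2 hpx.symm
  have htp : t ≠ p := ne_of_mem_of_not_mem h.ht h.p_notMem
  have hside := h.crit.side_eq hx h.hp
  obtain ⟨hg, F, hF, hxF⟩ := hG.good_flip h.good h.crit hx hlow
  have htF : t ∈ F := hG.mem_of_adj hg.1 hF hxF hxt <| by
    rw [flip_self, flip_of_ne _ hxt.ne', hside, ← flip_of_ne σ htp, ← flip_self,
      h.crit_p.side_eq (mem_insert_of_mem h.ht) (mem_insert_self _ _)]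
  have hE := hG.erase_eq_erase hg.1 (h.good_p hG).1 hside hF hxF h.crit_p (mem_insert_self _ _)
    htF (mem_insert_of_mem h.ht) hxt.ne' htp
  rw [erase_insert h.p_notMem] at hE
  exact { h with
    hq := hx
    adj := hpx
    low_q := hlow
    crit_q := by rw [← hE, insert_erase hxF]; exact hF
    q_notMem := by rw [← hE]; exact notMem_erase _ _
    adj_t := hxt }

theorem Linked.replace_t (h : Linked G n r σ A C p q t) (hG : Setting G n r) {x : V} (hx : x ∈ C)
    (hpx : G.Adj p x) (hlow : G.degree x = n) : Linked G n r σ A C p q x :=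
  { h with ht := hx, low_t := hlow, adj_t := ((h.adj_iff hG hx).1 hpx.symm).symm }

/-- Neighbours of `p` of degree `n` have the same closed neighbourhood as `p`. -/
theorem Linked.adj_of_low (h : Linked G n r σ A C p q t) (hG : Setting G n r) {x y : V}
    (hx : G.Adj p x) (hlow : G.degree x = n) (hy : G.Adj p y) (hyx : y ≠ x) : G.Adj x y := by
  rcases h.mem_or_mem hG hx with hxA | hxC
  · exact (h.replace_q hG hxA hx hlow).adj_q hG hy hyx
  · exact (h.replace_t hG hxC hx hlow).adj_t' hG hy hyx

end Linked

/-! ### From twin low vertices to a clique -/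

section Clique

variable {V : Type*} [Fintype V] [DecidableEq V] {G : SimpleGraph V} [DecidableRel G.Adj]
variable {n : ℕ} {p q t : V}

/-- In an `n`-critical graph, if all vertices in `N[p]` of degree `n` are adjacent to all of `N[p]`
and two vertices of larger degree in `N(p)` can share a colour, there is an `n`-colouring. -/
theorem not_exists_shared_colour (hc : ¬ ColOn G univ n) (hn : 0 < n)
    (hdeg : ∀ v, G.degree v ≤ n + 1) (hp : G.degree p = n) (hq : G.degree q = n)
    (hpq : G.Adj p q) (hcl : ∀ y, G.Adj p y → y ≠ q → G.Adj q y) {w₁ w₂ : V}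
    (h₁ : G.Adj p w₁) (h₂ : G.Adj p w₂) (h₁q : w₁ ≠ q) (h₂q : w₂ ≠ q) (hne : w₁ ≠ w₂)
    (hna : ¬ G.Adj w₁ w₂) {c : V → Fin n}
    (hcol : ∀ x ∈ univ.erase p, ∀ y ∈ univ.erase p, G.Adj x y → c x ≠ c y) {γ : Fin n}
    (hγ₁ : ∀ x, x ≠ p → ¬ G.Adj p x → G.Adj w₁ x → c x ≠ γ)
    (hγ₂ : ∀ x, x ≠ p → ¬ G.Adj p x → G.Adj w₂ x → c x ≠ γ) : False := by
  let O : Finset V := univ.filter fun x => x ≠ p ∧ ¬ G.Adj p x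
  have hO : ∀ x, x ∈ O ↔ x ≠ p ∧ ¬ G.Adj p x := fun x => by simp [O]
  let S : Finset V := insert w₁ (insert w₂ O)
  let R : Finset V := (univ.erase p).erase q
  have hSR : S ⊆ R := by
    intro x hx
    simp only [S, mem_insert, hO] at hx
    simp only [R, mem_erase, mem_univ, and_true]
    rcases hx with rfl | rfl | ⟨h, h'⟩
    · exact ⟨h₁q, h₁.ne'⟩
    · exact ⟨h₂q, h₂.ne'⟩
    · exact ⟨fun e => h' (e ▸ hpq), h⟩
  have hw : ∀ w x, (w = w₁ ∨ w = w₂) → x ∈ S → G.Adj w x → x ∈ O ∧ c x ≠ γ := by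
    intro w x hw hx ha
    simp only [S, mem_insert] at hx
    rcases hw with rfl | rfl <;> rcases hx with rfl | rfl | hx
    · exact absurd ha (G.loopless.irrefl _)
    · exact absurd ha hna
    · exact ⟨hx, hγ₁ x ((hO x).1 hx).1 ((hO x).1 hx).2 ha⟩
    · exact absurd ha.symm hna
    · exact absurd ha (G.loopless.irrefl _)
    · exact ⟨hx, hγ₂ x ((hO x).1 hx).1 ((hO x).1 hx).2 ha⟩
  have hOw : ∀ x ∈ O, ¬ (x = w₁ ∨ x = w₂) := by
    rintro x hx (rfl | rfl)
    · exact ((hO _).1 hx).2 h₁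
    · exact ((hO _).1 hx).2 h₂
  obtain ⟨c₀, hc₀, e₁, e₂⟩ : ∃ c₀ : V → Fin n,
      (∀ x ∈ S, ∀ y ∈ S, G.Adj x y → c₀ x ≠ c₀ y) ∧ c₀ w₁ = γ ∧ c₀ w₂ = γ := by
    refine ⟨fun v => if v = w₁ ∨ v = w₂ then γ else c v, fun x hx y hy ha => ?_, by simp, by simp⟩
    by_cases hxw : x = w₁ ∨ x = w₂
    · obtain ⟨hyO, hyγ⟩ := hw x y hxw hy ha
      simpa only [if_pos hxw, if_neg (hOw y hyO)] using hyγ.symm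
    · by_cases hyw : y = w₁ ∨ y = w₂
      · obtain ⟨-, hxγ⟩ := hw y x hyw hx ha.symm
        simpa only [if_neg hxw, if_pos hyw] using hxγ
      · have hxR := mem_of_mem_erase (hSR hx)
        have hyR := mem_of_mem_erase (hSR hy)
        simpa only [if_neg hxw, if_neg hyw] using hcol x hxR y hyR ha
  -- The remaining neighbours of `p` come next: each has degree at most `n + 1`, with `p` and `q`
  -- still uncoloured.
  obtain ⟨c₁, hc₁, hext⟩ := exists_extend_set hc₀ (R \ S) disjoint_sdiff fun v hv => by
    rw [union_sdiff_of_subset hSR]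
    obtain ⟨hvR, hvS⟩ := mem_sdiff.1 hv
    simp only [R, mem_erase, mem_univ, and_true] at hvR
    have hpv : G.Adj p v := by
      by_contra hpv
      exact hvS (mem_insert_of_mem (mem_insert_of_mem ((hO v).2 ⟨hvR.2, hpv⟩)))
    have hqv := hcl v hpv hvR.1
    have hsub : R.filter (G.Adj v) ⊆ ((G.neighborFinset v).erase p).erase q := by
      intro x hx
      obtain ⟨hx, ha⟩ := mem_filter.1 hx
      simp only [R, mem_erase, mem_univ, and_true] at hx
      simp [hx, ha]
    have h := card_le_card hsub
    rw [card_erase_of_mem (by simp [hpq.ne', hqv.symm]), card_erase_of_mem (by simp [hpv.symm]),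
      G.card_neighborFinset_eq_degree] at h
    have := hdeg v
    omega
  rw [union_sdiff_of_subset hSR] at hc₁
  obtain ⟨c₂, hc₂, hext₂⟩ := exists_extend hc₁ (notMem_erase q _) <| by
    have hsub : R.filter (G.Adj q) ⊆ (G.neighborFinset q).erase p := by
      intro x hx
      obtain ⟨hx, ha⟩ := mem_filter.1 hx
      simp only [R, mem_erase, mem_univ, and_true] at hx
      simp [hx, ha]
    have h := card_le_card hsub
    rw [card_erase_of_mem (by simp [hpq.symm]), G.card_neighborFinset_eq_degree] at h
    exact card_image_le.trans_lt (by omega)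
  rw [insert_erase (mem_erase.2 ⟨hpq.ne', mem_univ _⟩)] at hc₂
  have hcw : c₂ w₁ = c₂ w₂ := by
    have m₁ : w₁ ∈ S := mem_insert_self _ _
    have m₂ : w₂ ∈ S := mem_insert_of_mem (mem_insert_self _ _)
    rw [hext₂ _ (hSR m₁), hext₂ _ (hSR m₂), hext _ m₁, hext _ m₂, e₁, e₂]
  -- The `n` neighbours of `p` use at most `n - 1` colours, because `w₁` and `w₂` agree.
  obtain ⟨c₃, hc₃, -⟩ := exists_extend hc₂ (notMem_erase p _) <| by
    have hsub : ((univ.erase p).filter (G.Adj p)).image c₂ ⊆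
        ((G.neighborFinset p).erase w₁).image c₂ := by
      intro x hx
      obtain ⟨y, hy, rfl⟩ := mem_image.1 hx
      have hpy := (mem_filter.1 hy).2
      by_cases hyw : y = w₁
      · exact mem_image.2 ⟨w₂, by simp [hne.symm, h₂], by rw [hyw, hcw]⟩
      · exact mem_image.2 ⟨y, by simp [hyw, hpy], rfl⟩
    have h := (card_le_card hsub).trans card_image_le
    rw [card_erase_of_mem (by simp [h₁]), G.card_neighborFinset_eq_degree] at h
    omega
  rw [insert_erase (mem_univ _)] at hc₃
  exact hc ⟨c₃, hc₃⟩

/-- This is where `5 ≤ n` is essential: `n = 4`, `h = 2` gives equality. -/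
theorem lt_mul_sub {h n : ℕ} (hn : 5 ≤ n) (h2 : 2 ≤ h) (hh : h + 2 ≤ n) : n < h * (n - h) := by
  obtain ⟨a, rfl⟩ := Nat.exists_eq_add_of_le h2
  obtain ⟨b, rfl⟩ := Nat.exists_eq_add_of_le hh
  rw [show 2 + a + 2 + b - (2 + a) = 2 + b by omega]
  nlinarith [Nat.zero_le (a * b)]

theorem isNClique_of_adj_of_low (hcrit : Critical G univ n) (hn : 5 ≤ n)
    (hdeg : ∀ v, G.degree v ≤ n + 1)
    (hind : ∀ v w, G.Adj v w → G.degree v = n ∨ G.degree w = n)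
    (hp : G.degree p = n) (hq : G.degree q = n) (ht : G.degree t = n)
    (hpq : G.Adj p q) (hpt : G.Adj p t) (hqt : q ≠ t)
    (hcl : ∀ x, G.Adj p x → G.degree x = n → ∀ y, G.Adj p y → y ≠ x → G.Adj x y) :
    G.IsNClique (n + 1) (insert p (G.neighborFinset p)) := by
  have hcard : (insert p (G.neighborFinset p)).card = n + 1 := by
    rw [card_insert_of_notMem (by simp), G.card_neighborFinset_eq_degree, hp]
  let H : Finset V := (G.neighborFinset p).filter fun v => G.degree v ≠ n
  have hH : ∀ x, x ∈ H ↔ G.Adj p x ∧ G.degree x ≠ n := fun x => by simp [H]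
  by_cases hcardH : H.card ≤ 1
  · refine ⟨?_, hcard⟩
    rw [coe_insert, SimpleGraph.isClique_insert]
    refine ⟨fun x hx y hy hxy => ?_, fun b hb _ => by simpa using hb⟩
    rw [mem_coe, SimpleGraph.mem_neighborFinset] at hx hy
    by_cases hxl : G.degree x = n
    · exact hcl x hx hxl y hy hxy.symm
    · by_cases hyl : G.degree y = n
      · exact (hcl y hy hyl x hx hxy).symm
      · exact absurd (card_le_one.1 hcardH x ((hH x).2 ⟨hx, hxl⟩) y ((hH y).2 ⟨hy, hyl⟩)) hxy
  · exfalso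
    obtain ⟨c, hc⟩ := hcrit.2 p (mem_univ p)
    let O : Finset V := univ.filter fun x => x ≠ p ∧ ¬ G.Adj p x
    let L : Finset V := (insert p (G.neighborFinset p)) \ H
    have hHsub : H ⊆ insert p (G.neighborFinset p) :=
      (filter_subset _ _).trans (subset_insert _ _)
    have hL : L.card = n + 1 - H.card := by rw [card_sdiff_of_subset hHsub, hcard]
    -- The three low vertices `p`, `q`, `t` give `H.card ≤ n - 2`, the upper bound needed in
    -- `lt_mul_sub`.
    have hL3 : 3 ≤ L.card := by
      have hsub : ({p, q, t} : Finset V) ⊆ L := by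
        intro x hx
        simp only [mem_insert, mem_singleton] at hx
        rcases hx with rfl | rfl | rfl <;> simp [L, *]
      have h3 : ({p, q, t} : Finset V).card = 3 := card_eq_three.2
        ⟨p, q, t, hpq.ne, hpt.ne, hqt, rfl⟩
      exact h3 ▸ card_le_card hsub
    have hHle : H.card ≤ n + 1 := hcard ▸ card_le_card hHsub
    -- The colours not seen by `w` outside N[p]. A high `w` is adjacent to all `n + 1 - H.card` low
    -- vertices of N[p], so at most `H.card` of its neighbours lie outside.
    let av : V → Finset (Fin n) := fun w => univ \ (O.filter (G.Adj w)).image c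
    have hav : ∀ w ∈ H, n - H.card ≤ (av w).card := by
      intro w hw
      obtain ⟨hpw, hwn⟩ := (hH w).1 hw
      have hdisj : Disjoint (O.filter (G.Adj w)) L := by
        rw [disjoint_left]
        intro x hx hxL
        have h1 := (mem_filter.1 (mem_filter.1 hx).1).2
        have h2 := (mem_sdiff.1 hxL).1
        simp [h1.1, h1.2] at h2
      have hsub : O.filter (G.Adj w) ∪ L ⊆ G.neighborFinset w := by
        refine union_subset (fun x hx => by simpa using (mem_filter.1 hx).2) fun x hx => ?_
        obtain ⟨hx1, hx2⟩ := mem_sdiff.1 hx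
        rw [SimpleGraph.mem_neighborFinset]
        rcases mem_insert.1 hx1 with rfl | hx1
        · exact hpw.symm
        · rw [SimpleGraph.mem_neighborFinset] at hx1
          have hxl : G.degree x = n := by
            by_contra hxl
            exact hx2 ((hH x).2 ⟨hx1, hxl⟩)
          exact (hcl x hx1 hxl w hpw (by rintro rfl; exact hwn hxl)).symm
      have h1 := card_le_card hsub
      rw [card_union_of_disjoint hdisj, G.card_neighborFinset_eq_degree] at h1
      have h2 := hdeg w
      have h3 : ((O.filter (G.Adj w)).image c).card ≤ (O.filter (G.Adj w)).card := card_image_le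
      have h4 : (av w).card = n - ((O.filter (G.Adj w)).image c).card := by
        rw [card_sdiff_of_subset (subset_univ _), card_univ, Fintype.card_fin]
      omega
    obtain ⟨w₁, hw₁, w₂, hw₂, hne, hnd⟩ : ∃ w₁ ∈ H, ∃ w₂ ∈ H, w₁ ≠ w₂ ∧
        ¬ Disjoint (av w₁) (av w₂) := by
      by_contra! hdis
      have h1 := card_biUnion (s := H) (t := av) fun x hx y hy hxy => hdis x hx y hy hxy
      have h2 : (H.biUnion av).card ≤ n := (card_le_univ _).trans_eq (Fintype.card_fin n)
      have h3 := card_nsmul_le_sum H (fun w => (av w).card) _ hav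
      have h4 := lt_mul_sub (h := H.card) hn (by omega) (by omega)
      rw [smul_eq_mul] at h3
      omega
    obtain ⟨γ, hγ₁, hγ₂⟩ := not_disjoint_iff.1 hnd
    have hO : ∀ w, γ ∈ av w → ∀ x, x ≠ p → ¬ G.Adj p x → G.Adj w x → c x ≠ γ :=
      fun w hw x hxp hpx hwx e => (mem_sdiff.1 hw).2 <|
        mem_image.2 ⟨x, mem_filter.2 ⟨mem_filter.2 ⟨mem_univ _, hxp, hpx⟩, hwx⟩, e⟩
    obtain ⟨h₁, h₁n⟩ := (hH w₁).1 hw₁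
    obtain ⟨h₂, h₂n⟩ := (hH w₂).1 hw₂
    exact not_exists_shared_colour hcrit.1 (by omega) hdeg hp hq hpq (hcl q hpq hq) h₁ h₂
      (by rintro rfl; exact h₁n hq) (by rintro rfl; exact h₂n hq) hne
      (fun ha => (hind _ _ ha).elim h₁n h₂n) hc (hO w₁ hγ₁) (hO w₂ hγ₂)

theorem Setting.exists_isNClique {r : Bool → ℕ} (hG : Setting G n r) (hn : 5 ≤ n) :
    ∃ M, G.IsNClique (n + 1) M := by
  obtain ⟨σ, A, C, p, q, t, h⟩ := hG.exists_linked
  exact ⟨_, isNClique_of_adj_of_low hG.critical hn hG.degree_le hG.low_of_adj h.low_p h.low_q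
    h.low_t h.adj (h.symm hG).adj_t h.adj_t.ne fun x hx hlow y hy hyx =>
      h.adj_of_low hG hx hlow hy hyx⟩

end Clique

/-! ### Reduction from the Ore-degree to a critical induced subgraph -/

section Ore

variable {V : Type*} {G : SimpleGraph V}

theorem colOn_univ_iff [Fintype V] {n : ℕ} : ColOn G univ n ↔ G.Colorable n := by
  constructor
  · rintro ⟨c, hc⟩
    exact ⟨SimpleGraph.Coloring.mk c fun {x y} h => hc x (mem_univ _) y (mem_univ _) h⟩
  · rintro ⟨c⟩
    exact ⟨c, fun x _ y _ h => c.valid h⟩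

theorem Critical.induce [DecidableEq V] {S : Finset V} {n : ℕ} (h : Critical G S n) (hn : 0 < n) :
    Critical (G.induce (S : Set V)) univ n := by
  refine ⟨fun ⟨c, hc⟩ => h.1 ⟨fun v => if hv : v ∈ S then c ⟨v, hv⟩ else ⟨0, hn⟩,
    fun x hx y hy ha => ?_⟩, fun v _ => ?_⟩
  · simpa only [dif_pos hx, dif_pos hy] using
      hc ⟨x, hx⟩ (mem_univ _) ⟨y, hy⟩ (mem_univ _) ha
  · obtain ⟨c, hc⟩ := h.2 v v.2
    refine ⟨fun x => c x, fun x hx y hy ha => hc x ?_ y ?_ ha⟩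
    · exact mem_erase.2 ⟨fun e => (mem_erase.1 hx).1 (Subtype.ext e), x.2⟩
    · exact mem_erase.2 ⟨fun e => (mem_erase.1 hy).1 (Subtype.ext e), y.2⟩

theorem degree_induce_le_degree [Fintype V] [DecidableEq V] [DecidableRel G.Adj] (S : Finset V)
    (v : (S : Set V)) : (G.induce (S : Set V)).degree v ≤ G.degree v := by
  rw [← SimpleGraph.card_neighborFinset_eq_degree, ← SimpleGraph.card_neighborFinset_eq_degree]
  refine card_le_card_of_injOn Subtype.val (fun x hx => ?_) Subtype.val_injective.injOn
  simpa using hx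

theorem degree_add_degree_le_oreDegree [Fintype V] [DecidableEq V] [DecidableRel G.Adj] {v w : V}
    (h : G.Adj v w) : G.degree v + G.degree w ≤ G.oreDegree :=
  le_sup (f := G.edgeOreDegree) (b := s(v, w)) (by simpa using h)

theorem exists_isNClique_of_oreDegree_le [Fintype V] [DecidableEq V] [DecidableRel G.Adj] {n : ℕ}
    (hn : 5 ≤ n) (hcol : ¬ G.Colorable n) (hθ : G.oreDegree ≤ 2 * n + 1) :
    ¬ G.CliqueFree (n + 1) := by
  obtain ⟨S, -, hS⟩ := exists_critical (mt colOn_univ_iff.1 hcol)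
  have hcrit := hS.induce (by omega)
  have hmin : ∀ v, n ≤ (G.induce (S : Set V)).degree v := fun v => by
    have := hcrit.le_card_nbrs (mem_univ v)
    rwa [← SimpleGraph.neighborFinset_eq_filter, SimpleGraph.card_neighborFinset_eq_degree] at this
  have hsum : ∀ v w, (G.induce (S : Set V)).Adj v w →
      (G.induce (S : Set V)).degree v + (G.induce (S : Set V)).degree w ≤ 2 * n + 1 :=
    fun v w h => (add_le_add (degree_induce_le_degree S v) (degree_induce_le_degree S w)).trans
      ((degree_add_degree_le_oreDegree (G := G) h).trans hθ)
  -- Any split of the colours into two parts of size at least 2 would serve.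
  have hG : Setting (G.induce (S : Set V)) n (fun b => if b then 2 else n - 2) :=
    { critical := hcrit
      degree_le := fun v => by
        have h0 := hmin v
        obtain ⟨w, hw⟩ := (SimpleGraph.degree_pos_iff_exists_adj _ _).1 ((by omega : 0 < n).trans_le h0)
        have h1 := hsum v w hw
        have h2 := hmin w
        omega
      low_of_adj := fun v w h => by
        have h1 := hsum v w h
        have h2 := hmin v
        have h3 := hmin w
        omega
      add_not := fun b => by cases b <;> simp <;> omega
      two_le := fun b => by cases b <;> simp; omega }
  obtain ⟨M, hM⟩ := hG.exists_isNClique hn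
  intro hfree
  exact hfree.comap ⟨(SimpleGraph.Embedding.induce (G := G) (S : Set V)).toCopy⟩ M hM

end Ore

end OreBrooks

theorem corollaryO {V : Type*} [Fintype V] [DecidableEq V] (G : SimpleGraph V)
    [DecidableRel G.Adj] (h6 : 6 ≤ G.chromaticNumber)
    (hθ : G.chromaticNumber = ((G.oreDegree / 2 + 1 : ℕ) : ℕ∞)) :
    (SimpleGraph.completeGraph (Fin G.chromaticNumber.toNat)).IsContained G := by
  rw [hθ] at h6
  have hn : 5 ≤ G.oreDegree / 2 := by
    have : 6 ≤ G.oreDegree / 2 + 1 := by exact_mod_cast h6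
    omega
  have hcol : ¬ G.Colorable (G.oreDegree / 2) := fun h => by
    have := SimpleGraph.chromaticNumber_le_iff_colorable.2 h
    rw [hθ, Nat.cast_le] at this
    omega
  have hclique := OreBrooks.exists_isNClique_of_oreDegree_le hn hcol (by omega)
  rw [hθ, ENat.toNat_natCast]
  exact ⟨(SimpleGraph.topEmbeddingOfNotCliqueFree hclique).toCopy⟩
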